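/- Let $P$ be a set (of letters). Formulae are built from the letters in $P$ with the two binary connectives $\vee$ and $\wedge$ (no constants). A symmetric biassociative intermuting (SAI) category is a category with two bifunctors $\vee$ and $\wedge$; for each $\otimes\in\{\vee,\wedge\}$ a natural isomorphism $b^{\otimes}_{A,B,C}\colon A\otimes(B\otimes C)\to(A\otimes B)\otimes C$ satisfying Mac Lane's pentagon and a natural isomorphism $c^{\otimes}_{A,B}\colon A\otimes B\to B\otimes A$ satisfying $c^{\otimes}_{B,A}\circ c^{\otimes}_{A,B}=\mathbf 1$ and Mac Lane's hexagon; and a natural transformation $c^k_{A,B,C,D}\colon (A\wedge B)\vee(C\wedge D)\to(A\vee C)\wedge(B\vee D)$ such that, for all objects, (1) $b^{\wedge}_{A\vee D,B\vee E,C\vee F}\circ(\mathbf 1_{A\vee D}\wedge c^k_{B,C,E,F})\circ c^k_{A,B\wedge C,D,E\wedge F}=(c^k_{A,B,D,E}\wedge\mathbf 1_{C\vee F})\circ c^k_{A\wedge B,C,D\wedge E,F}\circ(b^{\wedge}_{A,B,C}\vee b^{\wedge}_{D,E,F})$, (2) $(b^{\vee}_{A,B,C}\wedge b^{\vee}_{D,E,F})\circ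 c^k_{A,D,B\vee C,E\vee F}\circ(\mathbf 1_{A\wedge D}\vee c^k_{B,E,C,F})=c^k_{A\vee B,D\vee E,C,F}\circ(c^k_{A,D,B,E}\vee\mathbf 1_{C\wedge F})\circ b^{\vee}_{A\wedge D,B\wedge E,C\wedge F}$, (3) $c^{\wedge}_{A\vee C,B\vee D}\circ c^k_{A,B,C,D}=c^k_{B,A,D,C}\circ(c^{\wedge}_{A,B}\vee c^{\wedge}_{C,D})$, (4) $(c^{\vee}_{A,B}\wedge c^{\vee}_{C,D})\circ c^k_{A,C,B,D}=c^k_{B,D,A,C}\circ c^{\vee}_{A\wedge C,B\wedge D}$. Let $\mathcal A$ be the SAI category freely generated by $P$: its objects are the formulae, and its arrows are the equivalence classes of the arrow terms generated by $\circ$, $\vee$ and $\wedge$ from identities, the $b^{\otimes}$ and their inverses, the $c^{\otimes}$, and the $c^k$, with respect to the smallest congruence that makes $\mathcal A$ an SAI category. Call a formula diversified if every letter occurs in it at most once. Theorem. If $A$ and $B$ are diversified formulae, then there is at most one arrow $f\colon A\to B$ in $\mathcal A$. -/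

import Mathlib

open CategoryTheory

universe u

namespace FreeSAI

/-- The two binary connectives (tensors) `∨` and `∧`. -/
inductive Conn : Type
  | or
  | and

/-- Propositional formulae built from letters in `P` with the binary connectives `∨` and `∧`
and without constants. They are the objects of the category `𝒜`. -/
inductive Formula (P : Type u) : Type u
  | letter : P → Formula P
  | bin : Conn → Formula P → Formula P → Formula P

/-- Disjunction of formulae. -/
abbrev Formula.or {P : Type u} (A B : Formula P) : Formula P := Formula.bin Conn.or A B

/-- Conjunction of formulae. -/
abbrev Formula.and {P : Type u} (A B : Formula P) : Formula P := Formula.bin Conn.and A B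

/-- The list of occurrences of letters in a formula, from left to right. -/
def Formula.letters {P : Type u} : Formula P → List P
  | Formula.letter p => [p]
  | Formula.bin _ A B => A.letters ++ B.letters

/-- A formula is diversified if every letter occurs in it at most once. -/
def Formula.Diversified {P : Type u} (A : Formula P) : Prop := A.letters.Nodup

/-- Arrow terms of `𝒜`. For each of the two connectives `k` there are the associativity arrows `b`
in both directions, the symmetry `c`, and the operation `map` on arrow terms. The composition is
written in diagrammatic order, so `comp f g` is `g ∘ f`. -/
inductive Term {P : Type u} : Formula P → Formula P → Type u
  | id (A : Formula P) : Term A A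
  | comp {A B C : Formula P} (f : Term A B) (g : Term B C) : Term A C
  | map (k : Conn) {A B C D : Formula P} (f : Term A B) (g : Term C D) :
      Term (.bin k A C) (.bin k B D)
  | b (k : Conn) (A B C : Formula P) : Term (.bin k A (.bin k B C)) (.bin k (.bin k A B) C)
  | bInv (k : Conn) (A B C : Formula P) : Term (.bin k (.bin k A B) C) (.bin k A (.bin k B C))
  | c (k : Conn) (A B : Formula P) : Term (.bin k A B) (.bin k B A)
  | ck (A B C D : Formula P) : Term ((A.and B).or (C.and D)) ((A.or C).and (B.or D))

/-- Equality of arrow terms: the smallest congruence (with respect to composition, `∨` and `∧`)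
which makes a symmetric biassociative intermuting category out of formulae and arrow terms. -/
inductive Equal {P : Type u} : {A B : Formula P} → Term A B → Term A B → Prop
  -- equivalence relation
  | refl {A B : Formula P} (f : Term A B) : Equal f f
  | symm {A B : Formula P} {f g : Term A B} : Equal f g → Equal g f
  | trans {A B : Formula P} {f g h : Term A B} : Equal f g → Equal g h → Equal f h
  -- congruence
  | comp {A B C : Formula P} {f f' : Term A B} {g g' : Term B C} :
      Equal f f' → Equal g g' → Equal (.comp f g) (.comp f' g')
  | map (k : Conn) {A B C D : Formula P} {f f' : Term A B} {g g' : Term C D} :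
      Equal f f' → Equal g g' → Equal (.map k f g) (.map k f' g')
  -- category
  | id_comp {A B : Formula P} (f : Term A B) : Equal (.comp (.id A) f) f
  | comp_id {A B : Formula P} (f : Term A B) : Equal (.comp f (.id B)) f
  | assoc {A B C D : Formula P} (f : Term A B) (g : Term B C) (h : Term C D) :
      Equal (.comp (.comp f g) h) (.comp f (.comp g h))
  -- `∨` and `∧` are biendofunctors
  | map_id (k : Conn) (A B : Formula P) : Equal (.map k (.id A) (.id B)) (.id (.bin k A B))
  | map_comp (k : Conn) {A B C A' B' C' : Formula P}
      (f : Term A B) (g : Term B C) (f' : Term A' B') (g' : Term B' C') :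
      Equal (.map k (.comp f g) (.comp f' g')) (.comp (.map k f f') (.map k g g'))
  -- associativity is a natural isomorphism satisfying the pentagonal condition
  | b_bInv (k : Conn) (A B C : Formula P) :
      Equal (.comp (.b k A B C) (.bInv k A B C)) (.id _)
  | bInv_b (k : Conn) (A B C : Formula P) :
      Equal (.comp (.bInv k A B C) (.b k A B C)) (.id _)
  | b_natural (k : Conn) {A B C A' B' C' : Formula P}
      (f : Term A A') (g : Term B B') (h : Term C C') :
      Equal (.comp (.map k f (.map k g h)) (.b k A' B' C'))
        (.comp (.b k A B C) (.map k (.map k f g) h))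
  | pentagon (k : Conn) (A B C D : Formula P) :
      Equal (.comp (.b k A B (.bin k C D)) (.b k (.bin k A B) C D))
        (.comp (.map k (.id A) (.b k B C D))
          (.comp (.b k A (.bin k B C) D) (.map k (.b k A B C) (.id D))))
  -- symmetry is a self-inverse natural isomorphism satisfying the hexagonal condition
  | c_c (k : Conn) (A B : Formula P) : Equal (.comp (.c k A B) (.c k B A)) (.id _)
  | c_natural (k : Conn) {A B A' B' : Formula P} (f : Term A A') (g : Term B B') :
      Equal (.comp (.map k f g) (.c k A' B')) (.comp (.c k A B) (.map k g f))
  | hexagon (k : Conn) (A B C : Formula P) :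
      Equal (.comp (.b k A B C) (.comp (.c k (.bin k A B) C) (.b k C A B)))
        (.comp (.map k (.id A) (.c k B C))
          (.comp (.b k A C B) (.map k (.c k A C) (.id B))))
  -- intermutation is a natural transformation
  | ck_natural {A B C D A' B' C' D' : Formula P}
      (f : Term A A') (g : Term B B') (h : Term C C') (j : Term D D') :
      Equal (.comp (.map .or (.map .and f g) (.map .and h j)) (.ck A' B' C' D'))
        (.comp (.ck A B C D) (.map .and (.map .or f h) (.map .or g j)))
  -- coherence of intermutation with the associativity of `∧`
  | ck_b_and (A B C D E F : Formula P) :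
      Equal
        (.comp (.ck A (B.and C) D (E.and F))
          (.comp (.map .and (.id (A.or D)) (.ck B C E F))
            (.b .and (A.or D) (B.or E) (C.or F))))
        (.comp (.map .or (.b .and A B C) (.b .and D E F))
          (.comp (.ck (A.and B) C (D.and E) F)
            (.map .and (.ck A B D E) (.id (C.or F)))))
  -- coherence of intermutation with the associativity of `∨`
  | ck_b_or (A B C D E F : Formula P) :
      Equal
        (.comp (.map .or (.id (A.and D)) (.ck B E C F))
          (.comp (.ck A D (B.or C) (E.or F))
            (.map .and (.b .or A B C) (.b .or D E F))))
        (.comp (.b .or (A.and D) (B.and E) (C.and F))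
          (.comp (.map .or (.ck A D B E) (.id (C.and F)))
            (.ck (A.or B) (D.or E) C F)))
  -- coherence of intermutation with the symmetry of `∧`
  | ck_c_and (A B C D : Formula P) :
      Equal (.comp (.ck A B C D) (.c .and (A.or C) (B.or D)))
        (.comp (.map .or (.c .and A B) (.c .and C D)) (.ck B A D C))
  -- coherence of intermutation with the symmetry of `∨`
  | ck_c_or (A B C D : Formula P) :
      Equal (.comp (.ck A C B D) (.map .and (.c .or A B) (.c .or C D)))
        (.comp (.c .or (A.and C) (B.and D)) (.ck B D A C))

/-- Equality of arrow terms as a setoid. -/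
instance termSetoid {P : Type u} (A B : Formula P) : Setoid (Term A B) :=
  ⟨Equal, ⟨Equal.refl, Equal.symm, Equal.trans⟩⟩

/-- The symmetric biassociative intermuting category `𝒜` freely generated by the set of letters `P`:
its objects are formulae and its arrows are equivalence classes of arrow terms. -/
instance category (P : Type u) : Category.{u} (Formula P) where
  Hom A B := Quotient (termSetoid A B)
  id A := Quotient.mk _ (Term.id A)
  comp := Quotient.map₂ Term.comp (fun _ _ hf _ _ hg => Equal.comp hf hg)
  id_comp := by
    rintro A B ⟨f⟩
    exact Quotient.sound (Equal.id_comp f)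
  comp_id := by
    rintro A B ⟨f⟩
    exact Quotient.sound (Equal.comp_id f)
  assoc := by
    rintro A B C D ⟨f⟩ ⟨g⟩ ⟨h⟩
    exact Quotient.sound (Equal.assoc f g h)

end FreeSAI

/-! The induction is on the target. For a target `B k C`, colour each letter by whether it occurs in
`B`; as the target is diversified, all letters of `C` have the other colour. Deleting the letters of
one colour from a formula leaves its part of the other colour, and a suitable formula has a
canonical arrow, its splitting, to the `k`-composite of its two parts. Splitting is natural
(`Term.hom_comp_split`): an arrow followed by the splitting of its target is the splitting of its
source followed by `u k v`, for some arrows `u`, `v` between the parts. The splitting of `B k C`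
itself is an isomorphism and its parts are `B` and `C`, so `u` and `v` are unique by the induction
hypothesis, and with them the given arrow.

The splitting is built by recursion; passing a connective `l` requires an interchange of `l` with
`k`, called `swap`. For `l = k` it is the invertible middle-four interchange. For `k = ∧`, `l = ∨`
it is intermutation. For `k = ∨`, `l = ∧` intermutation points the wrong way, and every conjunction
is required to be of one colour. The predicate `Splits` collects these requirements; it passes from
the target of an arrow to its source.

Parts can be empty, so an empty formula, neutral for both connectives, is adjoined. Each connective
then gives a symmetric monoidal category, whose coherence handles the middle-four interchange. The
intermuting equations enter through `swap_assoc`, `swap_symmetry` and `ck_middle`, which give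
naturality of splitting at associativity, symmetry and intermutation. -/

namespace FreeSAI

variable {P : Type u}

/-! ### Bifunctors and structural isomorphisms of the free category -/

/-- The action of a connective on arrows of the free category. -/
def bimap (k : Conn) {A B C D : Formula P} (f : A ⟶ B) (g : C ⟶ D) :
    (Formula.bin k A C ⟶ Formula.bin k B D) :=
  Quotient.map₂ (Term.map k) (fun _ _ hf _ _ hg => Equal.map k hf hg) f g

/-- The class of an arrow term. -/
def Term.hom {A B : Formula P} (f : Term A B) : A ⟶ B := Quotient.mk _ f

/-- The associativity isomorphism of the free category. -/
def assocIso (k : Conn) (A B C : Formula P) :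
    Formula.bin k (Formula.bin k A B) C ≅ Formula.bin k A (Formula.bin k B C) where
  hom := (Term.bInv k A B C).hom
  inv := (Term.b k A B C).hom
  hom_inv_id := Quotient.sound (Equal.bInv_b k A B C)
  inv_hom_id := Quotient.sound (Equal.b_bInv k A B C)

/-- The symmetry isomorphism of the free category. -/
def symmIso (k : Conn) (A B : Formula P) : Formula.bin k A B ≅ Formula.bin k B A where
  hom := (Term.c k A B).hom
  inv := (Term.c k B A).hom
  hom_inv_id := Quotient.sound (Equal.c_c k A B)
  inv_hom_id := Quotient.sound (Equal.c_c k B A)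

@[simp] lemma bimap_id (k : Conn) (A B : Formula P) : bimap k (𝟙 A) (𝟙 B) = 𝟙 _ :=
  Quotient.sound (Equal.map_id k A B)

lemma bimap_comp (k : Conn) {A B C A' B' C' : Formula P}
    (f : A ⟶ B) (g : B ⟶ C) (f' : A' ⟶ B') (g' : B' ⟶ C') :
    bimap k (f ≫ g) (f' ≫ g') = bimap k f f' ≫ bimap k g g' := by
  rcases f with ⟨f⟩; rcases g with ⟨g⟩; rcases f' with ⟨f'⟩; rcases g' with ⟨g'⟩
  exact Quotient.sound (Equal.map_comp k f g f' g')

lemma assocIso_inv_naturality (k : Conn) {A B C A' B' C' : Formula P}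
    (f : A ⟶ A') (g : B ⟶ B') (h : C ⟶ C') :
    bimap k f (bimap k g h) ≫ (assocIso k A' B' C').inv =
      (assocIso k A B C).inv ≫ bimap k (bimap k f g) h := by
  rcases f with ⟨f⟩; rcases g with ⟨g⟩; rcases h with ⟨h⟩
  exact Quotient.sound (Equal.b_natural k f g h)

lemma symmIso_hom_naturality (k : Conn) {A B A' B' : Formula P} (f : A ⟶ A') (g : B ⟶ B') :
    bimap k f g ≫ (symmIso k A' B').hom = (symmIso k A B).hom ≫ bimap k g f := by
  rcases f with ⟨f⟩; rcases g with ⟨g⟩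
  exact Quotient.sound (Equal.c_natural k f g)

/-! ### Adjoining an empty formula -/

/-- The formulae together with an additional empty formula. -/
inductive Aug (P : Type u) : Type u
  | empty : Aug P
  | of : Formula P → Aug P

namespace Aug

/-- The arrows between formulae that are possibly empty. -/
def Hom : Aug P → Aug P → Type u
  | empty, empty => PUnit
  | of A, of B => A ⟶ B
  | empty, of _ => PEmpty
  | of _, empty => PEmpty

instance : Category.{u} (Aug P) where
  Hom := Hom
  id X := match X with
    | empty => PUnit.unit
    | of A => 𝟙 A
  comp {X Y Z} f g := match X, Y, Z, f, g with
    | empty, empty, empty, _, _ => PUnit.unit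
    | of _, of _, of _, f, g => CategoryStruct.comp (obj := Formula P) f g
    | empty, of _, _, f, _ => PEmpty.elim f
    | of _, empty, _, f, _ => PEmpty.elim f
    | _, of _, empty, _, g => PEmpty.elim g
    | _, empty, of _, _, g => PEmpty.elim g
  id_comp {X Y} f := by
    rcases X with _ | A <;> rcases Y with _ | B <;> try exact PEmpty.elim f
    · rfl
    · exact Category.id_comp (obj := Formula P) f
  comp_id {X Y} f := by
    rcases X with _ | A <;> rcases Y with _ | B <;> try exact PEmpty.elim f
    · rfl
    · exact Category.comp_id (obj := Formula P) f
  assoc {X Y Z W} f g h := by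
    rcases X with _ | A <;> rcases Y with _ | B <;> (try exact PEmpty.elim f) <;>
      rcases Z with _ | C <;> (try exact PEmpty.elim g) <;>
      rcases W with _ | D <;> try exact PEmpty.elim h
    · rfl
    · exact Category.assoc (obj := Formula P) f g h

/-- An arrow of the free category as an arrow between possibly empty formulae. -/
abbrev ofHom {A B : Formula P} (f : A ⟶ B) : of A ⟶ of B := f

instance : Subsingleton ((empty : Aug P) ⟶ empty) := inferInstanceAs (Subsingleton PUnit)

/-- A connective applied to formulae that are possibly empty; the empty formula is neutral. -/
def tens (k : Conn) : Aug P → Aug P → Aug P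
  | empty, Y => Y
  | of A, empty => of A
  | of A, of B => of (Formula.bin k A B)

/-- The action of a connective on arrows between possibly empty formulae. -/
def tensHom (k : Conn) : {X X' Y Y' : Aug P} → (X ⟶ X') → (Y ⟶ Y') →
    (tens k X Y ⟶ tens k X' Y')
  | empty, empty, _, _, _, g => g
  | of _, of _, empty, empty, f, _ => f
  | of _, of _, of _, of _, f, g => bimap k f g
  | empty, of _, _, _, f, _ => PEmpty.elim f
  | of _, empty, _, _, f, _ => PEmpty.elim f
  | _, _, empty, of _, _, g => PEmpty.elim g
  | _, _, of _, empty, _, g => PEmpty.elim g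

/-- Associativity for possibly empty formulae. -/
def assoc (k : Conn) : (X Y Z : Aug P) → (tens k (tens k X Y) Z ≅ tens k X (tens k Y Z))
  | empty, _, _ => Iso.refl _
  | of _, empty, _ => Iso.refl _
  | of _, of _, empty => Iso.refl _
  | of A, of B, of C =>
    { hom := (assocIso k A B C).hom
      inv := (assocIso k A B C).inv
      hom_inv_id := (assocIso k A B C).hom_inv_id
      inv_hom_id := (assocIso k A B C).inv_hom_id }

/-- The empty formula is neutral on the right. -/
def rightUnit (k : Conn) : (X : Aug P) → (tens k X empty ≅ X)
  | empty => Iso.refl _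
  | of _ => Iso.refl _

/-- Symmetry for possibly empty formulae. -/
def symmetry (k : Conn) : (X Y : Aug P) → (tens k X Y ≅ tens k Y X)
  | empty, empty => Iso.refl _
  | empty, of _ => Iso.refl _
  | of _, empty => Iso.refl _
  | of A, of B =>
    { hom := (symmIso k A B).hom
      inv := (symmIso k A B).inv
      hom_inv_id := (symmIso k A B).hom_inv_id
      inv_hom_id := (symmIso k A B).inv_hom_id }

lemma tensHom_id (k : Conn) (X Y : Aug P) : tensHom k (𝟙 X) (𝟙 Y) = 𝟙 (tens k X Y) := by
  rcases X with _ | A <;> rcases Y with _ | B <;> try rfl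
  exact bimap_id k A B

lemma tensHom_comp (k : Conn) {X Y Z X' Y' Z' : Aug P}
    (f : X ⟶ Y) (g : Y ⟶ Z) (f' : X' ⟶ Y') (g' : Y' ⟶ Z') :
    tensHom k (f ≫ g) (f' ≫ g') = tensHom k f f' ≫ tensHom k g g' := by
  rcases X with _ | _ <;> rcases Y with _ | _ <;> (try exact PEmpty.elim f) <;>
    rcases Z with _ | _ <;> (try exact PEmpty.elim g) <;>
    rcases X' with _ | _ <;> rcases Y' with _ | _ <;> (try exact PEmpty.elim f') <;>
    rcases Z' with _ | _ <;> (try exact PEmpty.elim g') <;> try rfl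
  exact bimap_comp k f g f' g'

lemma assoc_inv_naturality (k : Conn) {X Y Z X' Y' Z' : Aug P}
    (f : X ⟶ X') (g : Y ⟶ Y') (h : Z ⟶ Z') :
    tensHom k f (tensHom k g h) ≫ (assoc k X' Y' Z').inv =
      (assoc k X Y Z).inv ≫ tensHom k (tensHom k f g) h := by
  rcases X with _ | A <;> rcases X' with _ | A' <;> (try exact PEmpty.elim f) <;>
    rcases Y with _ | B <;> rcases Y' with _ | B' <;> (try exact PEmpty.elim g) <;>
    rcases Z with _ | C <;> rcases Z' with _ | C' <;> (try exact PEmpty.elim h) <;>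
    first
    | exact assocIso_inv_naturality k f g h
    | exact (Category.comp_id _).trans (Category.id_comp _).symm

lemma symmetry_hom_naturality (k : Conn) {X Y X' Y' : Aug P} (f : X ⟶ X') (g : Y ⟶ Y') :
    tensHom k f g ≫ (symmetry k X' Y').hom = (symmetry k X Y).hom ≫ tensHom k g f := by
  rcases X with _ | A <;> rcases X' with _ | A' <;> (try exact PEmpty.elim f) <;>
    rcases Y with _ | B <;> rcases Y' with _ | B' <;> (try exact PEmpty.elim g) <;>
    first
    | exact symmIso_hom_naturality k f g
    | exact (Category.comp_id _).trans (Category.id_comp _).symm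

/-- The axioms are stated for `b`, which is the inverse of `assoc`, so the inverse form is the one
that can be quoted. As soon as one argument is empty, only identities and cancelling composites
remain. -/
lemma pentagon_inv (k : Conn) (X Y Z W : Aug P) :
    (assoc k X Y (tens k Z W)).inv ≫ (assoc k (tens k X Y) Z W).inv =
      tensHom k (𝟙 X) (assoc k Y Z W).inv ≫ (assoc k X (tens k Y Z) W).inv ≫
        tensHom k (assoc k X Y Z).inv (𝟙 W) := by
  rcases X with _ | A <;> rcases Y with _ | B <;> rcases Z with _ | C <;> rcases W with _ | D
  case of.of.of.of => exact Quotient.sound (Equal.pentagon k A B C D)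
  all_goals
    dsimp only [tens, assoc, symmetry, tensHom, Iso.refl_inv, Iso.refl_hom]
    repeat first | rfl | erw [bimap_id] | erw [Category.id_comp (obj := Aug P)] | erw [Category.comp_id (obj := Aug P)]

lemma hexagon_inv (k : Conn) (X Y Z : Aug P) :
    (assoc k X Y Z).inv ≫ (symmetry k (tens k X Y) Z).hom ≫ (assoc k Z X Y).inv =
      tensHom k (𝟙 X) (symmetry k Y Z).hom ≫ (assoc k X Z Y).inv ≫
        tensHom k (symmetry k X Z).hom (𝟙 Y) := by
  rcases X with _ | A <;> rcases Y with _ | B <;> rcases Z with _ | C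
  case of.of.of => exact Quotient.sound (Equal.hexagon k A B C)
  all_goals
    dsimp only [tens, assoc, symmetry, tensHom, Iso.refl_inv, Iso.refl_hom]
    repeat first | rfl | erw [bimap_id] | erw [Category.id_comp (obj := Aug P)] | erw [Category.comp_id (obj := Aug P)]

lemma assoc_hom_naturality (k : Conn) {X Y Z X' Y' Z' : Aug P}
    (f : X ⟶ X') (g : Y ⟶ Y') (h : Z ⟶ Z') :
    tensHom k (tensHom k f g) h ≫ (assoc k X' Y' Z').hom =
      (assoc k X Y Z).hom ≫ tensHom k f (tensHom k g h) := by
  rw [← Iso.inv_comp_eq, ← Category.assoc, ← assoc_inv_naturality, Category.assoc,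
    Iso.inv_hom_id, Category.comp_id]

/-- A connective applied to two isomorphisms. -/
@[simps]
def tensIso (k : Conn) {X X' Y Y' : Aug P} (e : X ≅ X') (e' : Y ≅ Y') :
    tens k X Y ≅ tens k X' Y' where
  hom := tensHom k e.hom e'.hom
  inv := tensHom k e.inv e'.inv
  hom_inv_id := by rw [← tensHom_comp, e.hom_inv_id, e'.hom_inv_id, tensHom_id]
  inv_hom_id := by rw [← tensHom_comp, e.inv_hom_id, e'.inv_hom_id, tensHom_id]

lemma pentagon_hom (k : Conn) (X Y Z W : Aug P) :
    tensHom k (assoc k X Y Z).hom (𝟙 W) ≫ (assoc k X (tens k Y Z) W).hom ≫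
        tensHom k (𝟙 X) (assoc k Y Z W).hom =
      (assoc k (tens k X Y) Z W).hom ≫ (assoc k X Y (tens k Z W)).hom := by
  have h : tensIso k (assoc k X Y Z) (Iso.refl W) ≪≫ assoc k X (tens k Y Z) W ≪≫
      tensIso k (Iso.refl X) (assoc k Y Z W) =
      assoc k (tens k X Y) Z W ≪≫ assoc k X Y (tens k Z W) :=
    Iso.ext_inv (by simpa using (pentagon_inv k X Y Z W).symm)
  simpa using congrArg Iso.hom h

@[simp] lemma symmetry_symmetry (k : Conn) (X Y : Aug P) :
    (symmetry k X Y).hom ≫ (symmetry k Y X).hom = 𝟙 _ := by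
  rcases X with _ | A <;> rcases Y with _ | B
  case of.of => exact (symmIso k A B).hom_inv_id
  all_goals exact Category.id_comp _

lemma symmetry_inv (k : Conn) (X Y : Aug P) : (symmetry k X Y).inv = (symmetry k Y X).hom := by
  rw [← cancel_epi (symmetry k X Y).hom, symmetry_symmetry, Iso.hom_inv_id]

lemma hexagon_hom (k : Conn) (X Y Z : Aug P) :
    (assoc k X Y Z).hom ≫ (symmetry k X (tens k Y Z)).hom ≫ (assoc k Y Z X).hom =
      tensHom k (symmetry k X Y).hom (𝟙 Z) ≫ (assoc k Y X Z).hom ≫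
        tensHom k (𝟙 Y) (symmetry k X Z).hom := by
  have h : assoc k X Y Z ≪≫ (symmetry k (tens k Y Z) X).symm ≪≫ assoc k Y Z X =
      tensIso k (symmetry k Y X).symm (Iso.refl Z) ≪≫ assoc k Y X Z ≪≫
        tensIso k (Iso.refl Y) (symmetry k Z X).symm :=
    Iso.ext_inv (by simpa using hexagon_inv k Y Z X)
  simpa [symmetry_inv] using congrArg Iso.hom h

lemma tensHom_id_comp (k : Conn) (W : Aug P) {X Y Z : Aug P} (f : X ⟶ Y) (g : Y ⟶ Z) :
    tensHom k (𝟙 W) (f ≫ g) = tensHom k (𝟙 W) f ≫ tensHom k (𝟙 W) g := by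
  rw [← tensHom_comp, Category.comp_id]

lemma tensHom_comp_id (k : Conn) (W : Aug P) {X Y Z : Aug P} (f : X ⟶ Y) (g : Y ⟶ Z) :
    tensHom k (f ≫ g) (𝟙 W) = tensHom k f (𝟙 W) ≫ tensHom k g (𝟙 W) := by
  rw [← tensHom_comp, Category.comp_id]

/-! ### Each connective as a symmetric monoidal structure -/

/-- The monoidal structure given by a connective. -/
abbrev monoidalStruct (k : Conn) : MonoidalCategoryStruct (Aug P) where
  tensorObj := tens k
  tensorHom f g := tensHom k f g
  whiskerLeft X _ _ f := tensHom k (𝟙 X) f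
  whiskerRight f Y := tensHom k f (𝟙 Y)
  tensorUnit := empty
  associator := assoc k
  leftUnitor X := Iso.refl X
  rightUnitor := rightUnit k

/-- The monoidal category given by a connective. -/
abbrev monoidal (k : Conn) : MonoidalCategory (Aug P) :=
  letI : MonoidalCategoryStruct (Aug P) := monoidalStruct k
  MonoidalCategory.ofTensorHom (tensHom_id k) (fun _ _ _ _ => rfl) (fun _ _ => rfl)
    (fun f₁ f₂ g₁ g₂ => (tensHom_comp k f₁ g₁ f₂ g₂).symm)
    (fun f g h => assoc_hom_naturality k f g h)
    (fun f => (Category.comp_id _).trans (Category.id_comp _).symm)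
    (fun {X Y} f => by
      rcases X with _ | A <;> rcases Y with _ | B <;> first | exact PEmpty.elim f | skip
      all_goals exact (Category.comp_id _).trans (Category.id_comp _).symm)
    (fun W X Y Z => pentagon_hom k W X Y Z)
    (fun X Y => by
      change (assoc k X empty Y).hom ≫ tensHom k (𝟙 X) (𝟙 Y) =
        tensHom k (rightUnit k X).hom (𝟙 Y)
      rcases X with _ | A
      · exact Category.id_comp _
      · exact Category.id_comp _)

/-- The symmetric monoidal category given by a connective. -/
abbrev symmetric (k : Conn) : @SymmetricCategory (Aug P) _ (monoidal k) :=
  letI : MonoidalCategory (Aug P) := monoidal k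
  { braiding := symmetry k
    braiding_naturality_right := fun X _ _ f => symmetry_hom_naturality k (𝟙 X) f
    braiding_naturality_left := fun f Z => symmetry_hom_naturality k f (𝟙 Z)
    hexagon_forward := hexagon_hom k
    hexagon_reverse := hexagon_inv k
    symmetry := symmetry_symmetry k }

end Aug

open MonoidalCategory in
/-- The interchange morphism of a symmetric monoidal category is compatible with the symmetry. -/
lemma tensorμ_braiding {C : Type*} [Category C] [MonoidalCategory C] [SymmetricCategory C]
    (X₁ X₂ Y₁ Y₂ : C) :
    (β_ (X₁ ⊗ X₂) (Y₁ ⊗ Y₂)).hom ≫ tensorμ Y₁ Y₂ X₁ X₂ =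
      tensorμ X₁ X₂ Y₁ Y₂ ≫ ((β_ X₁ Y₁).hom ⊗ₘ (β_ X₂ Y₂).hom) := by
  simp [tensorμ, SymmetricCategory.braiding_swap_eq_inv_braiding X₁ Y₂, MonoidalCategory.tensorHom_def]

/-! ### Interchange of two connectives -/

namespace Aug
variable {P : Type u}

/-- The middle-four interchange of a connective with itself. -/
def middle (k : Conn) (x x' y y' : Aug P) :
    tens k (tens k x x') (tens k y y') ⟶ tens k (tens k x y) (tens k x' y') :=
  (assoc k x x' (tens k y y')).hom ≫
    tensHom k (𝟙 x) ((assoc k x' y y').inv ≫ tensHom k (symmetry k x' y).hom (𝟙 y') ≫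
      (assoc k y x' y').hom) ≫
    (assoc k x y (tens k x' y')).inv

/-- Gives access to the general coherence results for `tensorμ`, so that naturality, associativity
and symmetry of `middle` need no diagram chase. -/
lemma middle_eq_tensorμ (k : Conn) (x x' y y' : Aug P) :
    middle k x x' y y' =
      letI := monoidal (P := P) k
      letI := symmetric (P := P) k
      MonoidalCategory.tensorμ x x' y y' := by
  simp only [middle, tensHom_id_comp, Category.assoc]
  rfl

lemma middle_isIso (k : Conn) (x x' y y' : Aug P) : IsIso (middle k x x' y y') :=
  inferInstanceAs (IsIso (assoc k x x' (tens k y y') ≪≫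
    tensIso k (Iso.refl x) ((assoc k x' y y').symm ≪≫ tensIso k (symmetry k x' y) (Iso.refl y') ≪≫
      assoc k y x' y') ≪≫ (assoc k x y (tens k x' y')).symm).hom)

lemma middle_naturality (k : Conn) {x x' y y' X X' Y Y' : Aug P} (f : x ⟶ X) (f' : x' ⟶ X')
    (g : y ⟶ Y) (g' : y' ⟶ Y') :
    tensHom k (tensHom k f f') (tensHom k g g') ≫ middle k X X' Y Y' =
      middle k x x' y y' ≫ tensHom k (tensHom k f g) (tensHom k f' g') := by
  rw [middle_eq_tensorμ, middle_eq_tensorμ]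
  exact @MonoidalCategory.tensorμ_natural _ _ (monoidal k) (symmetric k).toBraidedCategory
    _ _ _ _ _ _ _ _ f f' g g'

lemma middle_assoc (k : Conn) (x x' y y' z z' : Aug P) :
    tensHom k (middle k x x' y y') (𝟙 _) ≫ middle k (tens k x y) (tens k x' y') z z' ≫
        tensHom k (assoc k x y z).hom (assoc k x' y' z').hom =
      (assoc k _ _ _).hom ≫ tensHom k (𝟙 _) (middle k y y' z z') ≫
        middle k x x' (tens k y z) (tens k y' z') := by
  simp only [middle_eq_tensorμ]
  exact @MonoidalCategory.tensor_associativity _ _ (monoidal k) (symmetric k).toBraidedCategory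
    x x' y y' z z'

lemma middle_symmetry (k : Conn) (x x' y y' : Aug P) :
    (symmetry k (tens k x x') (tens k y y')).hom ≫ middle k y y' x x' =
      middle k x x' y y' ≫ tensHom k (symmetry k x y).hom (symmetry k x' y').hom := by
  simp only [middle_eq_tensorμ]
  exact @tensorμ_braiding _ _ (monoidal k) (symmetric k) x x' y y'

/-- No arrow joins the empty formula to a nonempty one. This carries `Compat`, which depends only on
emptiness, from the parts of a target back to those of a source. -/
lemma eq_empty_iff_of_hom {X Y : Aug P} (f : X ⟶ Y) : X = empty ↔ Y = empty := by
  rcases X with _ | A <;> rcases Y with _ | B <;> first | exact PEmpty.elim f | simp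

@[simp] lemma tens_eq_empty (k : Conn) (X Y : Aug P) :
    tens k X Y = empty ↔ X = empty ∧ Y = empty := by
  rcases X with _ | A <;> rcases Y with _ | B <;> simp [tens]

/-- The intermutation of possibly empty formulae, where the first and the third one, as well as the
second and the fourth one, are simultaneously empty. -/
def ck : (x x' y y' : Aug P) → (x = empty ↔ y = empty) → (x' = empty ↔ y' = empty) →
    (tens .or (tens .and x x') (tens .and y y') ⟶ tens .and (tens .or x y) (tens .or x' y'))
  | empty, empty, empty, empty, _, _ => 𝟙 _
  | empty, of A, empty, of B, _, _ => 𝟙 (of (Formula.or A B))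
  | of A, empty, of B, empty, _, _ => 𝟙 (of (Formula.or A B))
  | of A, of B, of C, of D, _, _ => (Term.ck A B C D).hom
  | empty, _, of _, _, h, _ => absurd (h.1 rfl) (by simp)
  | of _, _, empty, _, h, _ => absurd (h.2 rfl) (by simp)
  | _, empty, _, of _, _, h => absurd (h.1 rfl) (by simp)
  | _, of _, _, empty, _, h => absurd (h.2 rfl) (by simp)

/-- The interchange of a conjunction of disjunctions into a disjunction of conjunctions in which
the first or the second disjunct is empty. -/
def pure : (x x' y y' : Aug P) → (x = empty ∧ y = empty ∨ x' = empty ∧ y' = empty) →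
    (tens .and (tens .or x x') (tens .or y y') ⟶ tens .or (tens .and x y) (tens .and x' y'))
  | empty, _, empty, _, _ => 𝟙 _
  | of A, empty, of B, empty, _ => 𝟙 (of (Formula.and A B))
  | of A, empty, empty, empty, _ => 𝟙 (of A)
  | empty, empty, of B, empty, _ => 𝟙 (of B)
  | of _, of _, _, _, h => absurd h (by simp)
  | _, _, of _, of _, h => absurd h (by simp)
  | of _, empty, empty, of _, h => absurd h (by simp)
  | empty, of _, of _, empty, h => absurd h (by simp)

/-- The condition under which `swap` is available. -/
def Compat : Conn → Conn → (x x' y y' : Aug P) → Prop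
  | .and, .or, x, x', y, y' => (x = empty ↔ y = empty) ∧ (x' = empty ↔ y' = empty)
  | .or, .and, x, x', y, y' => x = empty ∧ y = empty ∨ x' = empty ∧ y' = empty
  | .and, .and, _, _, _, _ => True
  | .or, .or, _, _, _, _ => True

/-- The interchange of the connectives `k` and `l`. -/
def swap : (k l : Conn) → (x x' y y' : Aug P) → Compat k l x x' y y' →
    (tens l (tens k x x') (tens k y y') ⟶ tens k (tens l x y) (tens l x' y'))
  | .and, .or, x, x', y, y', h => ck x x' y y' h.1 h.2
  | .or, .and, x, x', y, y', h => pure x x' y y' h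
  | .and, .and, x, x', y, y', _ => middle .and x x' y y'
  | .or, .or, x, x', y, y', _ => middle .or x x' y y'

lemma Compat.of_iff {k l : Conn} {x x' y y' X X' Y Y' : Aug P} (h : Compat k l X X' Y Y')
    (f : x = empty ↔ X = empty) (f' : x' = empty ↔ X' = empty)
    (g : y = empty ↔ Y = empty) (g' : y' = empty ↔ Y' = empty) : Compat k l x x' y y' := by
  rcases k <;> rcases l <;> simp_all [Compat]

lemma Compat.assoc_iff {k l : Conn} {x x' y y' z z' : Aug P} :
    Compat k l x x' y y' ∧ Compat k l (tens l x y) (tens l x' y') z z' ↔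
      Compat k l y y' z z' ∧ Compat k l x x' (tens l y z) (tens l y' z') := by
  rcases k <;> rcases l <;> simp [Compat] <;> tauto

lemma Compat.symm {k l : Conn} {x x' y y' : Aug P} (h : Compat k l x x' y y') :
    Compat k l y y' x x' := by
  rcases k <;> rcases l <;> simp [Compat] at h ⊢ <;> tauto

lemma ck_naturality {x x' y y' X X' Y Y' : Aug P} (f : x ⟶ X) (f' : x' ⟶ X')
    (g : y ⟶ Y) (g' : y' ⟶ Y') (h h' H H') :
    tensHom .or (tensHom .and f f') (tensHom .and g g') ≫ ck X X' Y Y' H H' =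
      ck x x' y y' h h' ≫ tensHom .and (tensHom .or f g) (tensHom .or f' g') := by
  rcases x with _ | x <;> rcases X with _ | X <;> (try exact PEmpty.elim f) <;>
    rcases y with _ | y <;> (try (simp at h; done)) <;>
    rcases Y with _ | Y <;> (try exact PEmpty.elim g) <;>
    rcases x' with _ | x' <;> rcases X' with _ | X' <;> (try exact PEmpty.elim f') <;>
    rcases y' with _ | y' <;> (try (simp at h'; done)) <;>
    rcases Y' with _ | Y' <;> (try exact PEmpty.elim g')
  case of.of.of.of.of.of.of.of =>
    rcases f with ⟨f⟩; rcases f' with ⟨f'⟩; rcases g with ⟨g⟩; rcases g' with ⟨g'⟩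
    exact Quotient.sound (Equal.ck_natural f f' g g')
  all_goals exact (Category.comp_id _).trans (Category.id_comp _).symm

lemma pure_naturality {x x' y y' X X' Y Y' : Aug P} (f : x ⟶ X) (f' : x' ⟶ X')
    (g : y ⟶ Y) (g' : y' ⟶ Y') (h H) :
    tensHom .and (tensHom .or f f') (tensHom .or g g') ≫ pure X X' Y Y' H =
      pure x x' y y' h ≫ tensHom .or (tensHom .and f g) (tensHom .and f' g') := by
  rcases x with _ | x <;> rcases X with _ | X <;> (try exact PEmpty.elim f) <;>
    rcases y with _ | y <;> rcases Y with _ | Y <;> (try exact PEmpty.elim g) <;>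
    rcases x' with _ | x' <;> rcases X' with _ | X' <;> (try exact PEmpty.elim f') <;>
    rcases y' with _ | y' <;> rcases Y' with _ | Y' <;> (try exact PEmpty.elim g') <;>
    (try (simp at h; done)) <;>
    exact (Category.comp_id _).trans (Category.id_comp _).symm

lemma swap_naturality (k l : Conn) {x x' y y' X X' Y Y' : Aug P} (f : x ⟶ X) (f' : x' ⟶ X')
    (g : y ⟶ Y) (g' : y' ⟶ Y') (h H) :
    tensHom l (tensHom k f f') (tensHom k g g') ≫ swap k l X X' Y Y' H =
      swap k l x x' y y' h ≫ tensHom k (tensHom l f g) (tensHom l f' g') := by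
  rcases k <;> rcases l
  · exact middle_naturality _ f f' g g'
  · exact pure_naturality f f' g g' _ _
  · exact ck_naturality f f' g g' _ _ _ _
  · exact middle_naturality _ f f' g g'

lemma ck_symmetry_or (x x' y y' : Aug P) (h h') :
    (symmetry .or (tens .and x x') (tens .and y y')).hom ≫ ck y y' x x' h.symm h'.symm =
      ck x x' y y' h h' ≫ tensHom .and (symmetry .or x y).hom (symmetry .or x' y').hom := by
  rcases x with _ | x <;> rcases y with _ | y <;> (try (simp at h; done)) <;>
    rcases x' with _ | x' <;> rcases y' with _ | y' <;> (try (simp at h'; done))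
  case of.of.of.of => exact (Quotient.sound (Equal.ck_c_or x y x' y')).symm
  all_goals exact (Category.comp_id _).trans (Category.id_comp _).symm

lemma ck_symmetry_and (x x' y y' : Aug P) (h h') :
    tensHom .or (symmetry .and x x').hom (symmetry .and y y').hom ≫ ck x' x y' y h' h =
      ck x x' y y' h h' ≫ (symmetry .and (tens .or x y) (tens .or x' y')).hom := by
  rcases x with _ | x <;> rcases y with _ | y <;> (try (simp at h; done)) <;>
    rcases x' with _ | x' <;> rcases y' with _ | y' <;> (try (simp at h'; done))
  case of.of.of.of => exact (Quotient.sound (Equal.ck_c_and x x' y y')).symm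
  all_goals
    dsimp only [tens, symmetry, tensHom, ck, Iso.refl_inv, Iso.refl_hom]
    repeat first | rfl | erw [bimap_id] | erw [Category.id_comp (obj := Aug P)]

lemma pure_symmetry (x x' y y' : Aug P) (h h') :
    (symmetry .and (tens .or x x') (tens .or y y')).hom ≫ pure y y' x x' h' =
      pure x x' y y' h ≫ tensHom .or (symmetry .and x y).hom (symmetry .and x' y').hom := by
  rcases x with _ | x <;> rcases y with _ | y <;>
    rcases x' with _ | x' <;> rcases y' with _ | y' <;> (try (simp at h; done)) <;>
    exact (Category.comp_id _).trans (Category.id_comp _).symm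

lemma swap_symmetry (k l : Conn) (x x' y y' : Aug P) (h : Compat k l x x' y y') :
    (symmetry l (tens k x x') (tens k y y')).hom ≫ swap k l y y' x x' h.symm =
      swap k l x x' y y' h ≫ tensHom k (symmetry l x y).hom (symmetry l x' y').hom := by
  rcases k <;> rcases l
  · exact middle_symmetry _ x x' y y'
  · exact pure_symmetry x x' y y' _ _
  · exact ck_symmetry_or x x' y y' _ _
  · exact middle_symmetry _ x x' y y'

/-- With all six arguments nonempty this is the axiom `Equal.ck_b_or`. Otherwise a whole column is
empty, every `ck` is an identity, and both sides reduce to the associativity of `∨` on the other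
column, or to an identity. -/
lemma ck_assoc_or (x x' y y' z z' : Aug P) (h₁ h₁' h₂ h₂' h₃ h₃' h₄ h₄') :
    (assoc .or _ _ _).inv ≫ tensHom .or (ck x x' y y' h₁ h₁') (𝟙 _) ≫
        ck (tens .or x y) (tens .or x' y') z z' h₂ h₂' =
      tensHom .or (𝟙 _) (ck y y' z z' h₃ h₃') ≫
        ck x x' (tens .or y z) (tens .or y' z') h₄ h₄' ≫
          tensHom .and (assoc .or x y z).inv (assoc .or x' y' z').inv := by
  rcases x with _ | x <;> rcases y with _ | y <;> (try (simp at h₁; done)) <;>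
    rcases z with _ | z <;> (try (simp at h₃; done)) <;>
    rcases x' with _ | x' <;> rcases y' with _ | y' <;> (try (simp at h₁'; done)) <;>
    rcases z' with _ | z' <;> (try (simp at h₃'; done))
  case of.of.of.of.of.of => exact (Quotient.sound (Equal.ck_b_or x y z x' y' z')).symm
  all_goals
    dsimp only [tens, assoc, tensHom, ck, Iso.refl_inv, Iso.refl_hom]
    repeat first | rfl | erw [bimap_id] | erw [Category.id_comp (obj := Aug P)] |
      erw [Category.comp_id (obj := Aug P)]

lemma ck_assoc_and (x y z x' y' z' : Aug P) (hx : x = empty ↔ x' = empty)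
    (hy : y = empty ↔ y' = empty) (hz : z = empty ↔ z' = empty) (h₁ h₂) :
    ck x (tens .and y z) x' (tens .and y' z') hx h₁ ≫ tensHom .and (𝟙 _) (ck y z y' z' hy hz) ≫
        (assoc .and _ _ _).inv =
      tensHom .or (assoc .and x y z).inv (assoc .and x' y' z').inv ≫
        ck (tens .and x y) z (tens .and x' y') z' h₂ hz ≫
          tensHom .and (ck x y x' y' hx hy) (𝟙 _) := by
  rcases x with _ | x <;> rcases x' with _ | x' <;> (try (simp at hx; done)) <;>
    rcases y with _ | y <;> rcases y' with _ | y' <;> (try (simp at hy; done)) <;>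
    rcases z with _ | z <;> rcases z' with _ | z' <;> (try (simp at hz; done))
  case of.of.of.of.of.of => exact Quotient.sound (Equal.ck_b_and x y z x' y' z')
  all_goals
    dsimp only [tens, assoc, tensHom, ck, Iso.refl_inv, Iso.refl_hom]
    repeat first | rfl | erw [bimap_id] | erw [Category.id_comp (obj := Aug P)] |
      erw [Category.comp_id (obj := Aug P)]

lemma pure_assoc (x x' y y' z z' : Aug P) (h₁ h₂ h₃ h₄) :
    (assoc .and _ _ _).inv ≫ tensHom .and (pure x x' y y' h₁) (𝟙 _) ≫
        pure (tens .and x y) (tens .and x' y') z z' h₂ =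
      tensHom .and (𝟙 _) (pure y y' z z' h₃) ≫
        pure x x' (tens .and y z) (tens .and y' z') h₄ ≫
          tensHom .or (assoc .and x y z).inv (assoc .and x' y' z').inv := by
  rcases x with _ | x <;> rcases x' with _ | x' <;>
    rcases y with _ | y <;> rcases y' with _ | y' <;> (try (simp at h₁; done)) <;>
    rcases z with _ | z <;> rcases z' with _ | z' <;> (try (simp at h₃; done)) <;>
    (try (simp at h₂; done)) <;>
    dsimp only [tens, assoc, tensHom, pure, Iso.refl_inv, Iso.refl_hom] <;>
    repeat first | rfl | erw [bimap_id] | erw [Category.id_comp (obj := Aug P)] |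
      erw [Category.comp_id (obj := Aug P)]

lemma middle_assoc_inv (k : Conn) (x x' y y' z z' : Aug P) :
    (assoc k _ _ _).inv ≫ tensHom k (middle k x x' y y') (𝟙 _) ≫
        middle k (tens k x y) (tens k x' y') z z' =
      tensHom k (𝟙 _) (middle k y y' z z') ≫ middle k x x' (tens k y z) (tens k y' z') ≫
        tensHom k (assoc k x y z).inv (assoc k x' y' z').inv := by
  rw [Iso.inv_comp_eq, ← Category.assoc, ← Category.assoc,
    ← tensIso_inv, Iso.eq_comp_inv, tensIso_hom]
  simpa only [Category.assoc] using middle_assoc k x x' y y' z z'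

lemma swap_assoc (k l : Conn) (x x' y y' z z' : Aug P) (h₁ h₂ h₃ h₄) :
    (assoc l _ _ _).inv ≫ tensHom l (swap k l x x' y y' h₁) (𝟙 _) ≫
        swap k l (tens l x y) (tens l x' y') z z' h₂ =
      tensHom l (𝟙 _) (swap k l y y' z z' h₃) ≫
        swap k l x x' (tens l y z) (tens l y' z') h₄ ≫
          tensHom k (assoc l x y z).inv (assoc l x' y' z').inv := by
  rcases k <;> rcases l
  · exact middle_assoc_inv _ x x' y y' z z'
  · exact pure_assoc x x' y y' z z' _ _ _ _
  · exact ck_assoc_or x x' y y' z z' _ _ _ _ _ _ _ _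
  · exact middle_assoc_inv _ x x' y y' z z'

/-! ### Intermutation against the middle-four interchange of conjunction -/

lemma ck_assoc_and_hom (x y z x' y' z' : Aug P) (hx : x = empty ↔ x' = empty)
    (hy : y = empty ↔ y' = empty) (hz : z = empty ↔ z' = empty) (h₁ h₂) :
    ck (tens .and x y) z (tens .and x' y') z' h₂ hz ≫ tensHom .and (ck x y x' y' hx hy) (𝟙 _) ≫
        (assoc .and _ _ _).hom =
      tensHom .or (assoc .and x y z).hom (assoc .and x' y' z').hom ≫
        ck x (tens .and y z) x' (tens .and y' z') hx h₁ ≫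
          tensHom .and (𝟙 _) (ck y z y' z' hy hz) := by
  rw [← Category.assoc, ← Iso.eq_comp_inv, Category.assoc, Category.assoc,
    ck_assoc_and x y z x' y' z' hx hy hz h₁ h₂, ← Category.assoc, ← tensHom_comp,
    Iso.hom_inv_id, Iso.hom_inv_id, tensHom_id, Category.id_comp]

/-- Regroups two levels of intermutation so that conjuncts are detached one at a time from the left.
In this form the two sides of `ck_middle` differ only in the order of the two middle conjuncts. -/
lemma ck_tensHom_ck_assoc (x y z w x' y' z' w' : Aug P) (hx : x = empty ↔ x' = empty)
    (hy : y = empty ↔ y' = empty) (hz : z = empty ↔ z' = empty) (hw : w = empty ↔ w' = empty)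
    (h₁ h₂ h₃) :
    ck (tens .and x y) (tens .and z w) (tens .and x' y') (tens .and z' w') h₁ h₂ ≫
        tensHom .and (ck x y x' y' hx hy) (ck z w z' w' hz hw) ≫ (assoc .and _ _ _).hom =
      tensHom .or (assoc .and x y (tens .and z w)).hom (assoc .and x' y' (tens .and z' w')).hom ≫
        ck x (tens .and y (tens .and z w)) x' (tens .and y' (tens .and z' w')) hx h₃ ≫
          tensHom .and (𝟙 _) (ck y (tens .and z w) y' (tens .and z' w') hy h₂ ≫
            tensHom .and (𝟙 _) (ck z w z' w' hz hw)) := by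
  have e : tensHom .and (ck x y x' y' hx hy) (ck z w z' w' hz hw) =
      tensHom .and (ck x y x' y' hx hy) (𝟙 _) ≫
        tensHom .and (tensHom .and (𝟙 _) (𝟙 _)) (ck z w z' w' hz hw) := by
    rw [tensHom_id, ← tensHom_comp, Category.comp_id, Category.id_comp]
  rw [e, Category.assoc, assoc_hom_naturality, tensHom_id_comp]
  have := ck_assoc_and_hom x y (tens .and z w) x' y' (tens .and z' w') hx hy h₂ h₃ h₁
  rw [← Category.assoc, ← Category.assoc, Category.assoc (ck _ _ _ _ _ _), this]
  simp only [Category.assoc]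

/-- Two conjuncts detached in succession can be exchanged: associativity groups them together,
`ck_symmetry_and` swaps them inside one intermutation, and associativity separates them again. -/
lemma ck_ck_exchange (y z w y' z' w' : Aug P) (hy : y = empty ↔ y' = empty)
    (hz : z = empty ↔ z' = empty) (hw : w = empty ↔ w' = empty) (h₁ h₂) :
    (ck y (tens .and z w) y' (tens .and z' w') hy h₁ ≫
        tensHom .and (𝟙 _) (ck z w z' w' hz hw)) ≫
      (assoc .and _ _ _).inv ≫ tensHom .and (symmetry .and _ _).hom (𝟙 _) ≫
        (assoc .and _ _ _).hom =
    tensHom .or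
      ((assoc .and y z w).inv ≫ tensHom .and (symmetry .and y z).hom (𝟙 w) ≫
        (assoc .and z y w).hom)
      ((assoc .and y' z' w').inv ≫ tensHom .and (symmetry .and y' z').hom (𝟙 w') ≫
        (assoc .and z' y' w').hom) ≫
      ck z (tens .and y w) z' (tens .and y' w') hz h₂ ≫
        tensHom .and (𝟙 _) (ck y w y' w' hy hw) := by
  have h₃ : tens .and y z = empty ↔ tens .and y' z' = empty := by simp [hy, hz]
  have h₄ : tens .and z y = empty ↔ tens .and z' y' = empty := by simp [hy, hz]
  have e₁ := ck_assoc_and y z w y' z' w' hy hz hw h₁ h₃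
  have e₂ := ck_assoc_and_hom z y w z' y' w' hz hy hw h₂ h₄
  have e₃ := ck_symmetry_and y z y' z' hy hz
  have e₄ := ck_naturality (symmetry .and y z).hom (𝟙 w) (symmetry .and y' z').hom (𝟙 w')
    h₃ hw h₄ hw
  rw [tensHom_id] at e₄
  have e₅ := congrArg (fun f => tensHom .and f (𝟙 (tens .or w w'))) e₃
  simp only [tensHom_comp_id] at e₅
  simp only [tensHom_comp, Category.assoc]
  rw [← e₂, reassoc_of% e₄, reassoc_of% e₅, reassoc_of% e₁]

/-- Both sides are put in the form of `ck_tensHom_ck_assoc`; the outermost conjuncts `a`, `c` then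
stay fixed, and the exchange of the middle ones is `ck_ck_exchange` together with naturality of
`ck`. -/
lemma ck_middle (a a' b b' c c' d d' : Aug P) (h₁ : a = empty ↔ c = empty)
    (h₂ : a' = empty ↔ c' = empty) (h₃ : b = empty ↔ d = empty) (h₄ : b' = empty ↔ d' = empty)
    (h₅ h₆ h₇ h₈) :
    ck (tens .and a a') (tens .and b b') (tens .and c c') (tens .and d d') h₅ h₆ ≫
        tensHom .and (ck a a' c c' h₁ h₂) (ck b b' d d' h₃ h₄) ≫ middle .and _ _ _ _ =
      tensHom .or (middle .and a a' b b') (middle .and c c' d d') ≫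
        ck (tens .and a b) (tens .and a' b') (tens .and c d) (tens .and c' d') h₇ h₈ ≫
          tensHom .and (ck a b c d h₁ h₃) (ck a' b' c' d' h₂ h₄) := by
  have h₉ : tens .and a' (tens .and b b') = empty ↔ tens .and c' (tens .and d d') = empty := by
    simp [h₂, h₃, h₄]
  have h₁₀ : tens .and b (tens .and a' b') = empty ↔ tens .and d (tens .and c' d') = empty := by
    simp [h₂, h₃, h₄]
  have e₁ := ck_tensHom_ck_assoc a a' b b' c c' d d' h₁ h₂ h₃ h₄ h₅ h₆ h₉
  have e₂ := ck_tensHom_ck_assoc a b a' b' c d c' d' h₁ h₃ h₂ h₄ h₇ h₈ h₁₀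
  have e₃ := congrArg (tensHom .and (𝟙 (tens .or a c)))
    (ck_ck_exchange a' b b' c' d d' h₂ h₃ h₄ h₆ h₈)
  have e₄ := ck_naturality (𝟙 a) ((assoc .and a' b b').inv ≫
    tensHom .and (symmetry .and a' b).hom (𝟙 b') ≫ (assoc .and b a' b').hom) (𝟙 c)
    ((assoc .and c' d d').inv ≫
    tensHom .and (symmetry .and c' d).hom (𝟙 d') ≫ (assoc .and d c' d').hom) h₁ h₉ h₁ h₁₀
  rw [tensHom_id] at e₄
  -- The associators of `e₂` are moved to the opposite sides, since `middle` ends with an inverse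
  -- associator.
  rw [← Category.assoc, ← Iso.eq_comp_inv, ← tensIso_hom, Category.assoc,
    ← Iso.inv_comp_eq, tensIso_inv] at e₂
  simp only [tensHom_id_comp, tensHom_comp, Category.assoc] at e₁ e₂ e₃ e₄
  simp only [middle, tensHom_id_comp, tensHom_comp, Category.assoc]
  rw [reassoc_of% e₁, reassoc_of% e₃, e₂, reassoc_of% e₄]

lemma middle_empty_left (k : Conn) (A B : Formula P) :
    middle k empty (of A) empty (of B) = 𝟙 (of (Formula.bin k A B)) := by
  dsimp only [middle, tens, assoc, symmetry, tensHom, Iso.refl_inv, Iso.refl_hom]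
  repeat first | rfl | erw [bimap_id] | erw [Category.id_comp (obj := Aug P)] |
    erw [Category.comp_id (obj := Aug P)]

lemma middle_empty_right (k : Conn) (A B : Formula P) :
    middle k (of A) empty (of B) empty = 𝟙 (of (Formula.bin k A B)) := by
  dsimp only [middle, tens, assoc, symmetry, tensHom, Iso.refl_inv, Iso.refl_hom]
  repeat first | rfl | erw [bimap_id] | erw [Category.id_comp (obj := Aug P)] |
    erw [Category.comp_id (obj := Aug P)]

/-- When one colour is absent even the mixed interchanges are identities; hence one-coloured
formulae have invertible splittings. -/
lemma swap_isIso_right (k l : Conn) (A B : Formula P) (h) :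
    IsIso (swap k l (of A) empty (of B) empty h) := by
  rcases k <;> rcases l
  · exact middle_isIso _ _ _ _ _
  · exact inferInstanceAs (IsIso (𝟙 _))
  · exact inferInstanceAs (IsIso (𝟙 _))
  · exact middle_isIso _ _ _ _ _

lemma swap_isIso_left (k l : Conn) (A B : Formula P) (h) :
    IsIso (swap k l empty (of A) empty (of B) h) := by
  rcases k <;> rcases l
  · exact middle_isIso _ _ _ _ _
  · exact inferInstanceAs (IsIso (𝟙 _))
  · exact inferInstanceAs (IsIso (𝟙 _))
  · exact middle_isIso _ _ _ _ _

lemma tensHom_isIso (k : Conn) {X X' Y Y' : Aug P} (f : X ⟶ X') (g : Y ⟶ Y') [IsIso f] [IsIso g] :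
    IsIso (tensHom k f g) :=
  inferInstanceAs (IsIso (tensIso k (asIso f) (asIso g)).hom)

/-! ### Joining the splittings of two subformulae -/

/-- Two splittings with respect to `k` joined by the connective `l`. -/
def join (k l : Conn) {X Y x x' y y' : Aug P} (f : X ⟶ tens k x x') (g : Y ⟶ tens k y y')
    (h : Compat k l x x' y y') : tens l X Y ⟶ tens k (tens l x y) (tens l x' y') :=
  tensHom l f g ≫ swap k l x x' y y' h

lemma tensHom_comp_join (k l : Conn) {X Y x x' y y' X₁ Y₁ x₁ x₁' y₁ y₁' : Aug P}
    {f : X ⟶ tens k x x'} {g : Y ⟶ tens k y y'} {f₁ : X₁ ⟶ tens k x₁ x₁'}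
    {g₁ : Y₁ ⟶ tens k y₁ y₁'} {s : X ⟶ X₁} {t : Y ⟶ Y₁} {u : x ⟶ x₁} {u' : x' ⟶ x₁'}
    {v : y ⟶ y₁} {v' : y' ⟶ y₁'} (hs : s ≫ f₁ = f ≫ tensHom k u u')
    (ht : t ≫ g₁ = g ≫ tensHom k v v') (h h₁) :
    tensHom l s t ≫ join k l f₁ g₁ h₁ =
      join k l f g h ≫ tensHom k (tensHom l u v) (tensHom l u' v') := by
  rw [join, join, ← Category.assoc, ← tensHom_comp, hs, ht, tensHom_comp, Category.assoc,
    Category.assoc, swap_naturality k l u u' v v' h h₁]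

lemma assoc_inv_comp_join (k l : Conn) {X Y Z x x' y y' z z' : Aug P} (f : X ⟶ tens k x x')
    (g : Y ⟶ tens k y y') (j : Z ⟶ tens k z z') (h₁ h₂ h₃ h₄) :
    (assoc l X Y Z).inv ≫ join k l (join k l f g h₁) j h₂ =
      join k l f (join k l g j h₃) h₄ ≫ tensHom k (assoc l x y z).inv (assoc l x' y' z').inv := by
  have e₁ : join k l (join k l f g h₁) j h₂ =
      tensHom l (tensHom l f g) j ≫ tensHom l (swap k l x x' y y' h₁) (𝟙 _) ≫
        swap k l _ _ z z' h₂ := by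
    rw [← Category.assoc, ← tensHom_comp, Category.comp_id]; rfl
  have e₂ : join k l f (join k l g j h₃) h₄ =
      tensHom l f (tensHom l g j) ≫ tensHom l (𝟙 _) (swap k l y y' z z' h₃) ≫
        swap k l x x' _ _ h₄ := by
    rw [← Category.assoc, ← tensHom_comp, Category.comp_id]; rfl
  rw [e₁, e₂, ← Category.assoc, ← assoc_inv_naturality, Category.assoc,
    swap_assoc k l x x' y y' z z' h₁ h₂ h₃ h₄]
  simp only [Category.assoc]

lemma assoc_hom_comp_join (k l : Conn) {X Y Z x x' y y' z z' : Aug P} (f : X ⟶ tens k x x')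
    (g : Y ⟶ tens k y y') (j : Z ⟶ tens k z z') (h₁ h₂ h₃ h₄) :
    (assoc l X Y Z).hom ≫ join k l f (join k l g j h₃) h₄ =
      join k l (join k l f g h₁) j h₂ ≫
        tensHom k (assoc l x y z).hom (assoc l x' y' z').hom := by
  rw [← tensIso_hom, ← Iso.comp_inv_eq, Category.assoc, tensIso_inv,
    ← assoc_inv_comp_join k l f g j h₁ h₂ h₃ h₄, Iso.hom_inv_id_assoc]

lemma symmetry_comp_join (k l : Conn) {X Y x x' y y' : Aug P} (f : X ⟶ tens k x x')
    (g : Y ⟶ tens k y y') (h : Compat k l x x' y y') :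
    (symmetry l X Y).hom ≫ join k l g f h.symm =
      join k l f g h ≫ tensHom k (symmetry l x y).hom (symmetry l x' y').hom := by
  rw [join, join, ← Category.assoc, ← symmetry_hom_naturality, Category.assoc, Category.assoc,
    swap_symmetry]

/-- Naturality of `ck` brings the splittings of the four subformulae to the front; what is left is
exactly `ck_middle`. -/
lemma ck_comp_join {A B C D : Formula P} {a a' b b' c c' d d' : Aug P}
    (f : of A ⟶ tens .and a a') (g : of B ⟶ tens .and b b')
    (h : of C ⟶ tens .and c c') (j : of D ⟶ tens .and d d')
    (h₁ : Compat .and .or a a' c c') (h₂ : Compat .and .or b b' d d') (h₃) :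
    ofHom (Term.ck A B C D).hom ≫
        join .and .and (join .and .or f h h₁) (join .and .or g j h₂) trivial =
      join .and .or (join .and .and f g trivial) (join .and .and h j trivial) h₃ ≫
        tensHom .and (ck a b c d h₁.1 h₂.1) (ck a' b' c' d' h₁.2 h₂.2) := by
  have e₁ := ck_naturality f g h j (by simp) (by simp)
    (by simp [h₁.1, h₁.2]) (by simp [h₂.1, h₂.2])
  have e₂ := ck_middle a a' b b' c c' d d' h₁.1 h₁.2 h₂.1 h₂.2 (by simp [h₁.1, h₁.2])
    (by simp [h₂.1, h₂.2]) h₃.1 h₃.2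
  simp only [join, tensHom_comp, Category.assoc]
  -- On nonempty formulae the augmented `ck` is the generator by definition, so `e₁` becomes
  -- applicable.
  change ck (of A) (of B) (of C) (of D) (by simp) (by simp) ≫ tensHom .and (tensHom .or f h) (tensHom .or g j) ≫
    tensHom .and (ck a a' c c' h₁.1 h₁.2) (ck b b' d d' h₂.1 h₂.2) ≫ middle .and _ _ _ _ =
    tensHom .or (tensHom .and f g) (tensHom .and h j) ≫
      tensHom .or (middle .and a a' b b') (middle .and c c' d d') ≫ ck _ _ _ _ h₃.1 h₃.2 ≫ _
  rw [← reassoc_of% e₁, e₂]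

/-- The target conjunction has a single colour by `H`, so all parts of the other colour are empty.
Every interchange involved is then an identity, and the equation is naturality of `ck` on the
remaining colour. -/
lemma exists_ck_comp_join {A B C D : Formula P} {a a' b b' c c' d d' : Aug P}
    (f : of A ⟶ tens .or a a') (g : of B ⟶ tens .or b b')
    (h : of C ⟶ tens .or c c') (j : of D ⟶ tens .or d d')
    (H : tens .or a c = empty ∧ tens .or b d = empty ∨
      tens .or a' c' = empty ∧ tens .or b' d' = empty) (h₁ h₂) :
    ∃ (u : tens .or (tens .and a b) (tens .and c d) ⟶ tens .and (tens .or a c) (tens .or b d))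
      (v : tens .or (tens .and a' b') (tens .and c' d') ⟶
        tens .and (tens .or a' c') (tens .or b' d')),
      ofHom (Term.ck A B C D).hom ≫
          join .or .and (join .or .or f h trivial) (join .or .or g j trivial) H =
        join .or .or (join .or .and f g h₁) (join .or .and h j h₂) trivial ≫
          tensHom .or u v := by
  simp only [join, swap]
  simp only [tens_eq_empty] at H
  rcases H with ⟨⟨rfl, rfl⟩, rfl, rfl⟩ | ⟨⟨rfl, rfl⟩, rfl, rfl⟩
  · rcases a' with _ | a'
    · exact PEmpty.elim f
    rcases b' with _ | b'
    · exact PEmpty.elim g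
    rcases c' with _ | c'
    · exact PEmpty.elim h
    rcases d' with _ | d'
    · exact PEmpty.elim j
    refine ⟨𝟙 empty, ck (of a') (of b') (of c') (of d') (by simp) (by simp), ?_⟩
    have e := ck_naturality (x := of A) (x' := of B) (y := of C) (y' := of D) (X := of a')
      (X' := of b') (Y := of c') (Y' := of d') f g h j (by simp) (by simp) (by simp) (by simp)
    dsimp only [pure, tens]
    erw [middle_empty_left, middle_empty_left, middle_empty_left]
    repeat first | erw [Category.id_comp (obj := Aug P)] | erw [Category.comp_id (obj := Aug P)]
    exact e.symm
  · rcases a with _ | a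
    · exact PEmpty.elim f
    rcases b with _ | b
    · exact PEmpty.elim g
    rcases c with _ | c
    · exact PEmpty.elim h
    rcases d with _ | d
    · exact PEmpty.elim j
    refine ⟨ck (of a) (of b) (of c) (of d) (by simp) (by simp), 𝟙 empty, ?_⟩
    have e := ck_naturality (x := of A) (x' := of B) (y := of C) (y' := of D) (X := of a)
      (X' := of b) (Y := of c) (Y' := of d) f g h j (by simp) (by simp) (by simp) (by simp)
    dsimp only [pure, tens]
    erw [middle_empty_right, middle_empty_right, middle_empty_right]
    repeat first | erw [Category.id_comp (obj := Aug P)] | erw [Category.comp_id (obj := Aug P)]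
    exact e.symm

lemma join_isIso (k l : Conn) {X Y x x' y y' : Aug P} (f : X ⟶ tens k x x')
    (g : Y ⟶ tens k y y') [IsIso f] [IsIso g] (h) (hs : IsIso (swap k l x x' y y' h)) :
    IsIso (join k l f g h) :=
  have := tensHom_isIso l f g
  inferInstanceAs (IsIso (_ ≫ _))

lemma exists_join_isIso_right (k l : Conn) {X Y x x' y y' : Aug P} {A B : Formula P}
    (f : X ⟶ tens k x x') (g : Y ⟶ tens k y y') [IsIso f] [IsIso g] (hx : x = of A)
    (hx' : x' = empty) (hy : y = of B) (hy' : y' = empty) : ∃ h, IsIso (join k l f g h) := by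
  subst hx hx' hy hy'
  have h : Compat k l (of A) empty (of B) empty := by rcases k <;> rcases l <;> simp [Compat]
  exact ⟨h, join_isIso k l f g h (swap_isIso_right k l A B h)⟩

lemma exists_join_isIso_left (k l : Conn) {X Y x x' y y' : Aug P} {A B : Formula P}
    (f : X ⟶ tens k x x') (g : Y ⟶ tens k y y') [IsIso f] [IsIso g] (hx : x = empty)
    (hx' : x' = of A) (hy : y = empty) (hy' : y' = of B) : ∃ h, IsIso (join k l f g h) := by
  subst hx hx' hy hy'
  have h : Compat k l empty (of A) empty (of B) := by rcases k <;> rcases l <;> simp [Compat]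
  exact ⟨h, join_isIso k l f g h (swap_isIso_left k l A B h)⟩

/-- Interchanging a connective with itself is always invertible. This is why the main connective of
the target is chosen as the one to split by. -/
lemma exists_join_self_isIso (k : Conn) {X Y x x' y y' : Aug P} (f : X ⟶ tens k x x')
    (g : Y ⟶ tens k y y') [IsIso f] [IsIso g] : ∃ h, IsIso (join k k f g h) := by
  cases k
  · exact ⟨trivial, join_isIso .or .or f g trivial (middle_isIso .or x x' y y')⟩
  · exact ⟨trivial, join_isIso .and .and f g trivial (middle_isIso .and x x' y y')⟩

lemma hom_subsingleton {B : Formula P} (h : ∀ {A : Formula P} (f g : A ⟶ B), f = g)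
    {X Y : Aug P} (hY : Y = of B) (f g : X ⟶ Y) : f = g := by
  subst hY
  rcases X with _ | A
  · exact PEmpty.elim f
  · exact h f g

end Aug

open Aug

/-! ### Splitting a formula along a two-colouring of its letters -/

/-- The part of a formula that is left when the letters outside the class `b` are deleted. -/
def Formula.part (χ : P → Bool) (b : Bool) : Formula P → Aug P
  | letter p => if χ p = b then of (letter p) else empty
  | bin k A B => tens k (A.part χ b) (B.part χ b)

/-- The condition under which a formula can be split with respect to a connective. -/
def Formula.Splits (χ : P → Bool) (k : Conn) : Formula P → Prop
  | letter _ => True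
  | bin l A B => A.Splits χ k ∧ B.Splits χ k ∧
      Compat k l (A.part χ true) (A.part χ false) (B.part χ true) (B.part χ false)

/-- The arrow from a formula to the composite of its two parts. -/
def Formula.split (χ : P → Bool) (k : Conn) : (A : Formula P) → A.Splits χ k →
    (of A ⟶ tens k (A.part χ true) (A.part χ false))
  -- One part is the letter and the other is empty, so source and target agree once the colour of
  -- `p` is known.
  | letter p, _ => eqToHom (by cases h : χ p <;> simp [part, h, tens])
  | bin l A B, h =>
    join k l (X := of A) (Y := of B) (A.split χ k h.1) (B.split χ k h.2.1) h.2.2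

/-- Splitting is natural. -/
theorem Term.hom_comp_split (χ : P → Bool) (k : Conn) {A B : Formula P} (f : Term A B) :
    ∀ hB : B.Splits χ k, ∃ (hA : A.Splits χ k) (u : A.part χ true ⟶ B.part χ true)
      (v : A.part χ false ⟶ B.part χ false),
      ofHom f.hom ≫ B.split χ k hB = A.split χ k hA ≫ tensHom k u v := by
  induction f with
  | id A =>
    intro h
    refine ⟨h, 𝟙 _, 𝟙 _, ?_⟩
    rw [tensHom_id, Category.comp_id]
    exact Category.id_comp _
  | @comp A B C f g ihf ihg =>
    intro h
    obtain ⟨h', u', v', e'⟩ := ihg h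
    obtain ⟨h'', u, v, e⟩ := ihf h'
    refine ⟨h'', u ≫ u', v ≫ v', ?_⟩
    rw [tensHom_comp, ← reassoc_of% e, ← e']
    exact Category.assoc (ofHom f.hom) (ofHom g.hom) _
  | @map l A B C D f g ihf ihg =>
    intro h
    obtain ⟨hf, u, v, e⟩ := ihf h.1
    obtain ⟨hg, u', v', e'⟩ := ihg h.2.1
    refine ⟨⟨hf, hg, h.2.2.of_iff (eq_empty_iff_of_hom u) (eq_empty_iff_of_hom v)
      (eq_empty_iff_of_hom u') (eq_empty_iff_of_hom v')⟩, tensHom l u u', tensHom l v v', ?_⟩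
    exact tensHom_comp_join k l e e' _ _
  | b l A B C =>
    intro ⟨⟨hA, hB, h₁⟩, hC, h₂⟩
    obtain ⟨h₃, h₄⟩ := Compat.assoc_iff.1 ⟨h₁, h₂⟩
    exact ⟨⟨hA, ⟨hB, hC, h₃⟩, h₄⟩, (assoc l _ _ _).inv, (assoc l _ _ _).inv,
      assoc_inv_comp_join k l (A.split χ k hA) (B.split χ k hB) (C.split χ k hC) h₁ h₂ h₃ h₄⟩
  | bInv l A B C =>
    intro ⟨hA, ⟨hB, hC, h₃⟩, h₄⟩
    obtain ⟨h₁, h₂⟩ := Compat.assoc_iff.2 ⟨h₃, h₄⟩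
    exact ⟨⟨⟨hA, hB, h₁⟩, hC, h₂⟩, (assoc l _ _ _).hom, (assoc l _ _ _).hom,
      assoc_hom_comp_join k l (A.split χ k hA) (B.split χ k hB) (C.split χ k hC) h₁ h₂ h₃ h₄⟩
  | c l A B =>
    intro ⟨hB, hA, h⟩
    exact ⟨⟨hA, hB, h.symm⟩, (symmetry l _ _).hom, (symmetry l _ _).hom,
      symmetry_comp_join k l (A.split χ k hA) (B.split χ k hB) h.symm⟩
  | ck A B C D =>
    intro ⟨⟨hA, hC, h₁⟩, ⟨hB, hD, h₂⟩, h₃⟩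
    rcases k
    -- Splitting by `∨`: the target conjunction has one colour, hence so do both conjunctions in the
    -- source.
    · have h₃' := h₃
      simp only [Compat, Formula.part, tens_eq_empty] at h₃'
      have h₄ : Compat .or .and (A.part χ true) (A.part χ false) (B.part χ true)
          (B.part χ false) := by simp only [Compat]; tauto
      have h₅ : Compat .or .and (C.part χ true) (C.part χ false) (D.part χ true)
          (D.part χ false) := by simp only [Compat]; tauto
      exact ⟨⟨⟨hA, hB, h₄⟩, ⟨hC, hD, h₅⟩, trivial⟩,
        exists_ck_comp_join (A.split χ .or hA) (B.split χ .or hB) (C.split χ .or hC)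
          (D.split χ .or hD) h₃ h₄ h₅⟩
    -- Splitting by `∧`: `A` and `C` contain the same colours, and so do `B` and `D`; hence the two
    -- disjuncts of the source contain the same colours.
    · have h₄ : Compat .and .or (tens .and (A.part χ true) (B.part χ true))
          (tens .and (A.part χ false) (B.part χ false))
          (tens .and (C.part χ true) (D.part χ true))
          (tens .and (C.part χ false) (D.part χ false)) := by
        simp only [Compat, tens_eq_empty] at h₁ h₂ ⊢; tauto
      exact ⟨⟨⟨hA, hB, trivial⟩, ⟨hC, hD, trivial⟩, h₄⟩, Aug.ck _ _ _ _ h₁.1 h₂.1,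
        Aug.ck _ _ _ _ h₁.2 h₂.2, ck_comp_join (A.split χ .and hA) (B.split χ .and hB)
          (C.split χ .and hC) (D.split χ .and hD) h₁ h₂ h₄⟩

/-- A formula all of whose letters belong to one class splits trivially. -/
lemma Formula.split_isIso (χ : P → Bool) (k : Conn) (b : Bool) (A : Formula P)
    (H : ∀ p ∈ A.letters, χ p = b) : A.part χ b = of A ∧ A.part χ (!b) = empty ∧
      ∃ h : A.Splits χ k, IsIso (A.split χ k h) := by
  induction A with
  | letter p =>
    have hp : χ p = b := H p (by simp [letters])
    exact ⟨by simp [part, hp], by simp [part, hp], trivial, inferInstanceAs (IsIso (eqToHom _))⟩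
  | bin l A B ihA ihB =>
    obtain ⟨eA, eA', hA, iA⟩ := ihA fun p hp => H p (by simp [letters, hp])
    obtain ⟨eB, eB', hB, iB⟩ := ihB fun p hp => H p (by simp [letters, hp])
    refine ⟨by simp [part, eA, eB, tens], by simp [part, eA', eB', tens], ?_⟩
    obtain ⟨h, i⟩ : ∃ h, IsIso (join k l (A.split χ k hA) (B.split χ k hB) h) := by
      cases b
      · exact exists_join_isIso_left k l _ _ eA' eA eB' eB
      · exact exists_join_isIso_right k l _ _ eA eA' eB eB'
    exact ⟨⟨hA, hB, h⟩, i⟩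

/-! ### Uniqueness of arrows -/

/-- The only arrows between letters are identities. -/
lemma Term.eq_letter {A B : Formula P} (f : Term A B) (p : P) (hB : B = .letter p) :
    A = .letter p ∧ HEq f.hom (𝟙 (Formula.letter p)) := by
  induction f with
  | id A => subst hB; exact ⟨rfl, HEq.rfl⟩
  | comp f g ihf ihg =>
    obtain ⟨rfl, hg⟩ := ihg hB
    obtain ⟨rfl, hf⟩ := ihf rfl
    subst hB
    refine ⟨rfl, heq_of_eq ?_⟩
    change f.hom ≫ g.hom = _
    rw [eq_of_heq hf, eq_of_heq hg, Category.comp_id]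
  -- Every remaining generator has a compound target.
  | _ => cases hB

/-- Arrows into a diversified formula are unique. -/
theorem hom_eq_of_diversified (B : Formula P) (hB : B.Diversified) :
    ∀ {A : Formula P} (f g : A ⟶ B), f = g := by
  classical
  induction B with
  | letter p =>
    rintro A ⟨f⟩ ⟨g⟩
    obtain ⟨rfl, hf⟩ := f.eq_letter p rfl
    exact (eq_of_heq hf).trans (eq_of_heq (g.eq_letter p rfl).2).symm
  | bin k B C ihB ihC =>
    rintro A ⟨f⟩ ⟨g⟩
    obtain ⟨hB', hC', hBC⟩ := List.nodup_append.1 hB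
    -- The colouring singles out the letters of `B`; diversification puts every letter of `C` in the
    -- other class.
    let χ : P → Bool := fun p => decide (p ∈ B.letters)
    obtain ⟨eB, eB', sB, iB⟩ := B.split_isIso χ k true fun p hp => by simp [χ, hp]
    obtain ⟨eC, eC', sC, iC⟩ := C.split_isIso χ k false fun p hp => by
      simpa [χ] using fun hp' => hBC p hp' p hp rfl
    obtain ⟨h, i⟩ := exists_join_self_isIso k (B.split χ k sB) (C.split χ k sC)
    have et : (Formula.bin k B C).part χ true = of B := by
      simp only [Bool.not_false] at eC'
      simp only [Formula.part, eB, eC', tens]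
    have ef : (Formula.bin k B C).part χ false = of C := by
      simp only [Bool.not_true] at eB'
      simp only [Formula.part, eB', eC, tens]
    obtain ⟨sA, u, v, e⟩ := f.hom_comp_split χ k ⟨sB, sC, h⟩
    obtain ⟨_, u', v', e'⟩ := g.hom_comp_split χ k ⟨sB, sC, h⟩
    -- The arrows between parts end in `B` and `C`, so the induction hypotheses identify them. The
    -- splitting of `A` is the same in both factorizations, so `f` and `g` agree after the splitting
    -- of the target, which is invertible.
    rw [hom_subsingleton (ihB hB') et u u', hom_subsingleton (ihC hC') ef v v', ← e'] at e
    have i' : IsIso ((Formula.bin k B C).split χ k ⟨sB, sC, h⟩) := i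
    exact (cancel_mono _).1 e

end FreeSAI


theorem theorem3p2 {P : Type u} (A B : FreeSAI.Formula P)
    (hA : A.Diversified) (hB : B.Diversified) (f g : A ⟶ B) : f = g :=
  FreeSAI.hom_eq_of_diversified B hB f g
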